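/- **Theorem (Oracle inequality for model comparison).** There is a universal constant $C>0$ such that the following holds. Let $\mathcal Z$ and $\mathcal F$ be spaces of samples and models, and let $\ell:\mathcal F\times\mathcal Z\to[a,b]$ be a loss function. Let $f_1,f_2\in\mathcal F$, let $t\ge 1$ be an integer, let $\mathcal P_1,\dots,\mathcal P_t$ be probability distributions on $\mathcal Z$, let $B_1,\dots,B_t\ge 1$ be integers, and let $z_{j,i}\sim\mathcal P_j$ ($1\le j\le t$, $1\le i\le B_j$) be independent samples. Write $$L_j(f)=\mathbb E_{z\sim\mathcal P_j}\,\ell(f,z),\qquad \Delta_j=L_j(f_1)-L_j(f_2),\qquad B_{t,k}=\sum_{j=t-k+1}^tB_j ,$$ $$\widetilde\sigma_{t,k}^2=\frac1{B_{t,k}}\sum_{j=t-k+1}^tB_j\,\mathrm{Var}_{z\sim\mathcal P_j}\bigl[\ell(f_1,z)-\ell(f_2,z)\bigr].$$ Put $u_{j,i}=\ell(f_1,z_{j,i})-\ell(f_2,z_{j,i})$, which lies in the interval $[a-b,\,b-a]$ of length $M=2(b-a)$. For $1\le k\le t$ let $$\widehat\Delta_{t,k}=\frac1{B_{t,k}}\sum_{j=t-k+1}^t\sum_{i=1}^{B_j}u_{j,i},$$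 let $\widehat v_{t,k}\ge 0$ be given, when $B_{t,k}\ge2$, by $$\widehat v_{t,k}^2=\frac1{B_{t,k}-1}\sum_{j=t-k+1}^t\sum_{i=1}^{B_j}\bigl(u_{j,i}-\widehat\Delta_{t,k}\bigr)^2 ,$$ and, for $\delta'\in(0,1)$, let $$\widehat\psi(t,k,\delta')=\begin{cases}M,&B_{t,k}=1,\\[2pt] \widehat v_{t,k}\sqrt{\dfrac{2\log(2/\delta')}{B_{t,k}}}+\dfrac{8M\log(2/\delta')}{3(B_{t,k}-1)},&B_{t,k}\ge2,\end{cases}$$ $$\widehat\phi(t,k,\delta')=\max_{1\le i\le k}\Bigl(|\widehat\Delta_{t,k}-\widehat\Delta_{t,i}|-\bigl[\widehat\psi(t,k,\delta')+\widehat\psi(t,i,\delta')\bigr]\Bigr)_+ .$$ The adaptive rolling window comparison chooses any $\widehat k\in\operatorname{argmin}_{1\le k\le t}\{\widehat\phi(t,k,\delta')+\widehat\psi(t,k,\delta')\}$ and outputs $\widehat f=f_1$ if $\widehat\Delta_{t,\widehat k}\le0$ and $\widehat f=f_2$ if $\widehat\Delta_{t,\widehat k}>0$. Let $\delta\in(0,1)$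 and take $\delta'=\delta/(3t)$. Then, with probability at least $1-\delta$, every possible output $\widehat f$ (that is, for every choice of the minimizer $\widehat k$) satisfies $$L_t(\widehat f)-\min_{r\in\{1,2\}}L_t(f_r)\;\le\; C\,\max\{1,b-a\}\,\log\frac{6t}{\delta}\;\min_{1\le k\le t}\left\{\max_{t-k+1\le j\le t}|\Delta_j-\Delta_t|+\frac{\widetilde\sigma_{t,k}}{\sqrt{B_{t,k}}}+\frac1{B_{t,k}}\right\}.$$ -/

import Mathlib

open MeasureTheory ProbabilityTheory

noncomputable section

namespace RollingWindow

/-- The look-back window `{t - k + 1, …, t}` of the `k` most recent periods (used for `1 ≤ k ≤ t`;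
periods are numbered `1, 2, …`). -/
def window (t k : ℕ) : Finset ℕ := Finset.Icc (t - k + 1) t

/-- `B_{t,k}`, the number of samples in the window. -/
def windowSize (B : ℕ → ℕ) (t k : ℕ) : ℕ := ∑ j ∈ window t k, B j

section MeanEstimation

variable {B : ℕ → ℕ}

/-- The window average `μ̂_{t,k}` of real data `u j i`, `i < B j`. -/
def muHat (u : (j : ℕ) → Fin (B j) → ℝ) (t k : ℕ) : ℝ :=
  (windowSize B t k : ℝ)⁻¹ * ∑ j ∈ window t k, ∑ i, u j i

/-- The sample standard deviation `v̂_{t,k}` over the window (used when `B_{t,k} ≥ 2`). -/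
def vHat (u : (j : ℕ) → Fin (B j) → ℝ) (t k : ℕ) : ℝ :=
  √(1 / ((windowSize B t k : ℝ) - 1) * ∑ j ∈ window t k, ∑ i, (u j i - muHat u t k) ^ 2)

/-- The variance proxy `ψ̂(t, k, δ)`, with range hyperparameter `M`. -/
def psiHat (u : (j : ℕ) → Fin (B j) → ℝ) (M δ : ℝ) (t k : ℕ) : ℝ :=
  if windowSize B t k = 1 then M
  else vHat u t k * √(2 * Real.log (2 / δ) / (windowSize B t k : ℝ))
    + 8 * M * Real.log (2 / δ) / (3 * ((windowSize B t k : ℝ) - 1))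

/-- The bias proxy `φ̂(t, k, δ)`: a maximum of positive parts over the smaller windows. -/
def phiHat (u : (j : ℕ) → Fin (B j) → ℝ) (M δ : ℝ) (t k : ℕ) : ℝ :=
  ⨆ i : Finset.Icc 1 k,
    max (|muHat u t k - muHat u t i| - (psiHat u M δ t k + psiHat u M δ t i)) 0

/-- `k` is an admissible adaptive window: a minimizer over `{1, …, t}` of `φ̂ + ψ̂`
(ties may be broken in any way). -/
def IsSelectedWindow (u : (j : ℕ) → Fin (B j) → ℝ) (M δ : ℝ) (t k : ℕ) : Prop :=
  k ∈ Finset.Icc 1 t ∧ ∀ k' ∈ Finset.Icc 1 t,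
    phiHat u M δ t k + psiHat u M δ t k ≤ phiHat u M δ t k' + psiHat u M δ t k'

end MeanEstimation

section Comparison

variable {F Z : Type*} {B : ℕ → ℕ}

/-- The loss differences `u_{j,i} = ℓ(f₁, z_{j,i}) - ℓ(f₂, z_{j,i})`. -/
def lossDiff (ℓ : F → Z → ℝ) (f₁ f₂ : F) (z : (j : ℕ) → Fin (B j) → Z) :
    (j : ℕ) → Fin (B j) → ℝ :=
  fun j i => ℓ f₁ (z j i) - ℓ f₂ (z j i)

/-- `f` is a possible output of the adaptive rolling window comparison of `f₁` and `f₂` on the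
data `z`: for some admissible adaptive window `k` for the loss differences, `f` is `f₁` if the
window average of the loss differences is nonpositive, and `f₂` otherwise. -/
def IsCompareOutput (ℓ : F → Z → ℝ) (f₁ f₂ : F) (z : (j : ℕ) → Fin (B j) → Z) (M δ : ℝ)
    (t : ℕ) (f : F) : Prop :=
  ∃ k, IsSelectedWindow (lossDiff ℓ f₁ f₂ z) M δ t k ∧
    (muHat (lossDiff ℓ f₁ f₂ z) t k ≤ 0 ∧ f = f₁ ∨
      0 < muHat (lossDiff ℓ f₁ f₂ z) t k ∧ f = f₂)

/-- The comparison always has an output. -/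
theorem exists_isCompareOutput (ℓ : F → Z → ℝ) (f₁ f₂ : F) (z : (j : ℕ) → Fin (B j) → Z)
    (M δ : ℝ) (t : ℕ) (ht : 1 ≤ t) : ∃ f, IsCompareOutput ℓ f₁ f₂ z M δ t f := by
  obtain ⟨k, hk, hmin⟩ := Finset.exists_min_image (Finset.Icc 1 t)
    (fun k => phiHat (lossDiff ℓ f₁ f₂ z) M δ t k + psiHat (lossDiff ℓ f₁ f₂ z) M δ t k)
    (Finset.nonempty_Icc.mpr ht)
  rcases le_or_gt (muHat (lossDiff ℓ f₁ f₂ z) t k) 0 with h | h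
  · exact ⟨f₁, k, ⟨hk, hmin⟩, Or.inl ⟨h, rfl⟩⟩
  · exact ⟨f₂, k, ⟨hk, hmin⟩, Or.inr ⟨h, rfl⟩⟩

variable [MeasurableSpace Z]

/-- The risk (population loss) of `f` under the distribution `P`. -/
def risk (ℓ : F → Z → ℝ) (P : Measure Z) (f : F) : ℝ := ∫ z, ℓ f z ∂P

/-- The performance gap `Δ_j` between `f₁` and `f₂` at time `j`. -/
def gap (ℓ : F → Z → ℝ) (P : ℕ → Measure Z) (f₁ f₂ : F) (j : ℕ) : ℝ :=
  risk ℓ (P j) f₁ - risk ℓ (P j) f₂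

/-- `σ̃_{t,k}`: the square root of the average over the window of the variances of the loss
difference. -/
def sigmaTilde (ℓ : F → Z → ℝ) (P : ℕ → Measure Z) (B : ℕ → ℕ) (f₁ f₂ : F) (t k : ℕ) : ℝ :=
  √(1 / (windowSize B t k : ℝ) *
    ∑ j ∈ window t k, (B j : ℝ) * variance (fun z => ℓ f₁ z - ℓ f₂ z) (P j))

/-- The bias-variance bound of the window `k`:
`max_{t-k+1 ≤ j ≤ t} |Δ_j - Δ_t| + σ̃_{t,k} / √B_{t,k} + 1 / B_{t,k}`. -/
def oracleBound (ℓ : F → Z → ℝ) (P : ℕ → Measure Z) (B : ℕ → ℕ) (f₁ f₂ : F) (t k : ℕ) : ℝ :=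
  (⨆ j : window t k, |gap ℓ P f₁ f₂ j - gap ℓ P f₁ f₂ t|)
    + sigmaTilde ℓ P B f₁ f₂ t k / √(windowSize B t k : ℝ) + 1 / (windowSize B t k : ℝ)

end Comparison

end RollingWindow

end

/-!
The sample variance over a window concentrates around the average variance of the samples plus the
average squared bias of their means, so the empirical Bernstein width `ψ̂` bounds the deviation of
each window average from its mean and is itself at most a multiple of the bias-variance bound. A
union bound makes this hold for all windows at once. Then `φ̂` is at most twice the bias, and by
minimality of `φ̂ + ψ̂` the selected window competes with every fixed one, as in Lepski's method.
Choosing the wrong model requires the estimated gap to have the wrong sign, so the excess risk is at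
most the estimation error of the current gap.
-/

namespace RollingWindow

open scoped BigOperators

section ExponentialBounds

lemma exp_le_one_add_add_sq_div {x c : ℝ} (hx : |x| ≤ c) (hc : c < 3) :
    Real.exp x ≤ 1 + x + x ^ 2 / (2 * (1 - c / 3)) := by
  have hc₀ : 0 ≤ c := (abs_nonneg x).trans hx
  have hexp : HasSum (fun k : ℕ => x ^ k / (k.factorial : ℝ)) (Real.exp x) := by
    rw [Real.exp_eq_exp_ℝ]
    exact NormedSpace.expSeries_div_hasSum_exp x
  have htail : HasSum (fun k : ℕ => x ^ (k + 2) / ((k + 2).factorial : ℝ))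
      (Real.exp x - (1 + x)) := by
    simpa [Finset.sum_range_succ] using (hasSum_nat_add_iff' 2).mpr hexp
  have hgeom : HasSum (fun k : ℕ => x ^ 2 / 2 * (c / 3) ^ k) (x ^ 2 / (2 * (1 - c / 3))) := by
    rw [div_mul_eq_div_div, div_eq_mul_inv (x ^ 2 / 2)]
    exact (hasSum_geometric_of_lt_one (by positivity) (by linarith)).mul_left _
  have hterm (k : ℕ) : x ^ (k + 2) / ((k + 2).factorial : ℝ) ≤ x ^ 2 / 2 * (c / 3) ^ k := by
    have hfact : (2 * 3 ^ k : ℝ) ≤ (k + 2).factorial := by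
      exact_mod_cast add_comm k 2 ▸ Nat.factorial_mul_pow_le_factorial (m := 2) (n := k)
    have hpow : x ^ k ≤ c ^ k := (le_abs_self _).trans (abs_pow x k ▸ by gcongr)
    calc x ^ (k + 2) / ((k + 2).factorial : ℝ)
        ≤ c ^ k * x ^ 2 / (2 * 3 ^ k) := by rw [pow_add]; gcongr
      _ = x ^ 2 / 2 * (c / 3) ^ k := by rw [div_pow]; field_simp
  linarith [hasSum_le hterm htail hgeom]

lemma exp_neg_le_one_sub_add_sq_div {x : ℝ} (hx : 0 ≤ x) :
    Real.exp (-x) ≤ 1 - x + x ^ 2 / 2 := by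
  rw [Real.exp_neg, inv_le_iff_one_le_mul₀ (Real.exp_pos x)]
  have hnonneg : 0 ≤ 1 - x + x ^ 2 / 2 := by nlinarith only [sq_nonneg (x - 1)]
  calc (1 : ℝ) ≤ (1 - x + x ^ 2 / 2) * (1 + x + x ^ 2 / 2) := by
        nlinarith only [sq_nonneg (x ^ 2)]
    _ ≤ (1 - x + x ^ 2 / 2) * Real.exp x := by
        gcongr
        exact Real.quadratic_le_exp_of_nonneg hx

lemma one_le_log_six_mul_div {t δ : ℝ} (ht : 1 ≤ t) (hδ_pos : 0 < δ) (hδ : δ ≤ 2) :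
    1 ≤ Real.log (6 * t / δ) := by
  rw [Real.le_log_iff_exp_le (by positivity), le_div_iff₀ hδ_pos]
  calc Real.exp 1 * δ ≤ 3 * 2 := by
        gcongr
        exact (Real.exp_one_lt_d9.trans (by norm_num)).le
    _ ≤ 6 * t := by linarith

end ExponentialBounds

section Subgamma

variable {Ω ι : Type*} {mΩ : MeasurableSpace Ω} {μ : Measure Ω}

lemma measureReal_lt_le_of_forall_lt_measureReal_le [IsFiniteMeasure μ] {X : Ω → ℝ} {x p : ℝ}
    (h : ∀ y, x < y → μ.real {ω | y ≤ X ω} ≤ p) : μ.real {ω | x < X ω} ≤ p := by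
  let s (n : ℕ) : Set Ω := {ω | x + 1 / ((n : ℝ) + 1) ≤ X ω}
  have hs_mono : Monotone s := fun m n hmn ω (hω : x + 1 / ((m : ℝ) + 1) ≤ X ω) =>
    (add_le_add_right (one_div_le_one_div_of_le (by positivity) (by gcongr)) x).trans hω
  have hs_union : {ω | x < X ω} ⊆ ⋃ n, s n := fun ω (hω : x < X ω) => by
    obtain ⟨n, hn⟩ := exists_nat_one_div_lt (sub_pos.mpr hω)
    exact Set.mem_iUnion.mpr ⟨n, (by linarith : x + 1 / ((n : ℝ) + 1) ≤ X ω)⟩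
  have hlim : Filter.Tendsto (fun n => μ.real (s n)) Filter.atTop (nhds (μ.real (⋃ n, s n))) :=
    (ENNReal.tendsto_toReal (measure_ne_top _ _)).comp (tendsto_measure_iUnion_atTop hs_mono)
  exact (measureReal_mono hs_union).trans
    (le_of_tendsto' hlim fun n => h _ (lt_add_of_pos_right x Nat.one_div_pos_of_nat))

lemma integrable_one_add_mul_add_mul_sq [IsFiniteMeasure μ] {X : Ω → ℝ} (hX : MemLp X 2 μ)
    (l q : ℝ) : Integrable (fun ω => 1 + l * X ω + q * X ω ^ 2) μ :=
  ((integrable_const 1).add ((hX.integrable one_le_two).const_mul l)).add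
    (hX.integrable_sq.const_mul q)

lemma integrable_exp_mul_of_exp_le_quadratic [IsFiniteMeasure μ] {X : Ω → ℝ} {l q : ℝ}
    (hX : MemLp X 2 μ) (hexp : ∀ᵐ ω ∂μ, Real.exp (l * X ω) ≤ 1 + l * X ω + q * X ω ^ 2) :
    Integrable (fun ω => Real.exp (l * X ω)) μ := by
  refine (integrable_one_add_mul_add_mul_sq hX l q).mono'
    (aemeasurable_exp_mul l hX.aemeasurable) ?_
  filter_upwards [hexp] with ω hω
  rwa [Real.norm_of_nonneg (Real.exp_pos _).le]

lemma mgf_sub_integral_le_of_exp_le_quadratic [IsProbabilityMeasure μ] {X : Ω → ℝ} {l q : ℝ}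
    (hX : MemLp X 2 μ) (hexp : ∀ᵐ ω ∂μ, Real.exp (l * X ω) ≤ 1 + l * X ω + q * X ω ^ 2) :
    mgf (fun ω => X ω - μ[X]) μ l ≤ Real.exp (q * ∫ ω, X ω ^ 2 ∂μ) := by
  have hX_int : Integrable X μ := hX.integrable one_le_two
  have hmgf : mgf X μ l ≤ 1 + l * μ[X] + q * ∫ ω, X ω ^ 2 ∂μ :=
    calc mgf X μ l ≤ ∫ ω, 1 + l * X ω + q * X ω ^ 2 ∂μ :=
          integral_mono_ae (integrable_exp_mul_of_exp_le_quadratic hX hexp)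
            (integrable_one_add_mul_add_mul_sq hX l q) hexp
      _ = 1 + l * μ[X] + q * ∫ ω, X ω ^ 2 ∂μ := by
          rw [integral_add (by fun_prop) (hX.integrable_sq.const_mul q),
            integral_add (by fun_prop) (by fun_prop), integral_const_mul, integral_const_mul,
            integral_const, probReal_univ, one_smul]
  calc mgf (fun ω => X ω - μ[X]) μ l = mgf X μ l * Real.exp (l * -μ[X]) := by
        simp only [sub_eq_add_neg, mgf_add_const]
    _ ≤ Real.exp (l * μ[X] + q * ∫ ω, X ω ^ 2 ∂μ) * Real.exp (l * -μ[X]) := by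
        gcongr
        linarith [Real.add_one_le_exp (l * μ[X] + q * ∫ ω, X ω ^ 2 ∂μ)]
    _ = Real.exp (q * ∫ ω, X ω ^ 2 ∂μ) := by rw [← Real.exp_add]; ring_nf

/-- The moment generating function of `X` is at most that of a sub-gamma variable with variance
factor `v` and scale `c`, on the right of zero only; `c = 0` is the sub-Gaussian case. It is the
common hypothesis of the Bernstein-type tail bounds below. -/
structure HasSubgammaMGF (X : Ω → ℝ) (v c : ℝ) (μ : Measure Ω) : Prop where
  integrable_exp_mul (l : ℝ) : 0 ≤ l → c * l < 1 → Integrable (fun ω => Real.exp (l * X ω)) μ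
  mgf_le (l : ℝ) : 0 ≤ l → c * l < 1 → mgf X μ l ≤ Real.exp (l ^ 2 * v / (2 * (1 - c * l)))

namespace HasSubgammaMGF

lemma measureReal_add_le_le [IsFiniteMeasure μ] {X : Ω → ℝ} {v c L r : ℝ}
    (hX : HasSubgammaMGF X v c μ) (hc : 0 ≤ c) (hL : 0 ≤ L) (hr : 0 < r) (hvr : 2 * v * L ≤ r ^ 2) :
    μ.real {ω | r + c * L ≤ X ω} ≤ Real.exp (-L) := by
  let l := 2 * L / (r + 2 * c * L)
  have : 0 < r + 2 * c * L := by positivity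
  have hl : 0 ≤ l := by positivity
  have hcl : 1 - c * l = r / (r + 2 * c * L) := by simp only [l]; field_simp; ring
  have hcl_lt : c * l < 1 := by linarith [hcl.trans_gt (by positivity : 0 < r / (r + 2 * c * L))]
  have hexponent : -l * (r + c * L) + l ^ 2 * v / (2 * (1 - c * l)) ≤ -L := by
    calc -l * (r + c * L) + l ^ 2 * v / (2 * (1 - c * l))
        = -l * (r + c * L) + L * (2 * v * L) / (r * (r + 2 * c * L)) := by
          rw [hcl]; simp only [l]; field_simp
      _ ≤ -l * (r + c * L) + L * r ^ 2 / (r * (r + 2 * c * L)) := by gcongr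
      _ = -L := by simp only [l]; field_simp; ring
  calc μ.real {ω | r + c * L ≤ X ω}
      ≤ Real.exp (-l * (r + c * L)) * mgf X μ l :=
        measure_ge_le_exp_mul_mgf _ hl (hX.integrable_exp_mul l hl hcl_lt)
    _ ≤ Real.exp (-l * (r + c * L)) * Real.exp (l ^ 2 * v / (2 * (1 - c * l))) := by
        gcongr
        exact hX.mgf_le l hl hcl_lt
    _ ≤ Real.exp (-L) := by
        rw [← Real.exp_add]
        exact Real.exp_le_exp.mpr hexponent

lemma measureReal_add_lt_le [IsFiniteMeasure μ] {X : Ω → ℝ} {v c L r : ℝ}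
    (hX : HasSubgammaMGF X v c μ) (hc : 0 ≤ c) (hL : 0 ≤ L) (hr : 0 ≤ r) (hvr : 2 * v * L ≤ r ^ 2) :
    μ.real {ω | r + c * L < X ω} ≤ Real.exp (-L) := by
  refine measureReal_lt_le_of_forall_lt_measureReal_le fun y hy => ?_
  have hry : r < y - c * L := by linarith
  simpa using hX.measureReal_add_le_le hc hL (hr.trans_lt hry) (hvr.trans (by gcongr))

lemma sum_of_iIndepFun {X : ι → Ω → ℝ} {v : ι → ℝ} {c : ℝ} {s : Finset ι}
    (hindep : iIndepFun X μ) (hmeas : ∀ i, AEMeasurable (X i) μ)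
    (hX : ∀ i ∈ s, HasSubgammaMGF (X i) (v i) c μ) :
    HasSubgammaMGF (∑ i ∈ s, X i) (∑ i ∈ s, v i) c μ := by
  have : IsProbabilityMeasure μ := hindep.isProbabilityMeasure
  refine ⟨fun l hl hcl => ?_, fun l hl hcl => ?_⟩
  · rw [← mgf_pos_iff, hindep.mgf_sum₀ hmeas]
    exact Finset.prod_pos fun i hi => mgf_pos ((hX i hi).integrable_exp_mul l hl hcl)
  · calc mgf (∑ i ∈ s, X i) μ l = ∏ i ∈ s, mgf (X i) μ l := hindep.mgf_sum₀ hmeas s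
      _ ≤ ∏ i ∈ s, Real.exp (l ^ 2 * v i / (2 * (1 - c * l))) :=
          Finset.prod_le_prod (fun _ _ => mgf_nonneg) fun i hi => (hX i hi).mgf_le l hl hcl
      _ = Real.exp (l ^ 2 * (∑ i ∈ s, v i) / (2 * (1 - c * l))) := by
          rw [← Real.exp_sum, Finset.mul_sum, Finset.sum_div]

lemma sub_integral_of_exp_le [IsProbabilityMeasure μ] {X : Ω → ℝ} {c : ℝ} (hX : MemLp X 2 μ)
    (hexp : ∀ l, 0 ≤ l → c * l < 1 → ∀ᵐ ω ∂μ,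
      Real.exp (l * X ω) ≤ 1 + l * X ω + l ^ 2 / (2 * (1 - c * l)) * X ω ^ 2) :
    HasSubgammaMGF (fun ω => X ω - μ[X]) (∫ ω, X ω ^ 2 ∂μ) c μ where
  integrable_exp_mul l hl hcl := by
    simp only [mul_sub, Real.exp_sub]
    exact (integrable_exp_mul_of_exp_le_quadratic hX (hexp l hl hcl)).div_const _
  mgf_le l hl hcl := by
    simpa only [div_mul_eq_mul_div] using
      mgf_sub_integral_le_of_exp_le_quadratic hX (hexp l hl hcl)

lemma sub_integral_of_mem_Icc [IsProbabilityMeasure μ] {X : Ω → ℝ} {a b : ℝ}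
    (hmeas : AEMeasurable X μ) (hX : ∀ᵐ ω ∂μ, X ω ∈ Set.Icc a b) :
    HasSubgammaMGF (fun ω => X ω - μ[X]) Var[X; μ] ((b - a) / 3) μ := by
  have hX_memLp : MemLp X 2 μ := memLp_of_bounded hX hmeas.aestronglyMeasurable 2
  have hX_int : Integrable X μ := hX_memLp.integrable one_le_two
  have hmean : μ[X] ∈ Set.Icc a b := (convex_Icc a b).integral_mem isClosed_Icc hX hX_int
  have hcentered : ∫ ω, (X ω - μ[X]) ∂μ = 0 := by
    rw [integral_sub hX_int (integrable_const _), integral_const, probReal_univ, one_smul, sub_self]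
  have hmgf := sub_integral_of_exp_le (c := (b - a) / 3) (hX_memLp.sub (memLp_const μ[X]))
    fun l hl hcl => ?_
  · simpa only [Pi.sub_apply, hcentered, sub_zero, ← variance_eq_integral hmeas] using hmgf
  · filter_upwards [hX] with ω hω
    have habs : |l * (X ω - μ[X])| ≤ l * (b - a) := by
      rw [abs_mul, abs_of_nonneg hl]
      gcongr
      exact abs_sub_le_of_le_of_le hω.1 hω.2 hmean.1 hmean.2
    calc Real.exp (l * (X ω - μ[X]))
        ≤ 1 + l * (X ω - μ[X]) + (l * (X ω - μ[X])) ^ 2 / (2 * (1 - l * (b - a) / 3)) :=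
          exp_le_one_add_add_sq_div habs (by linarith)
      _ = 1 + l * (X ω - μ[X]) + l ^ 2 / (2 * (1 - (b - a) / 3 * l)) * (X ω - μ[X]) ^ 2 := by
          ring_nf

lemma integral_sub_of_nonneg [IsProbabilityMeasure μ] {Y : Ω → ℝ} (hY : MemLp Y 2 μ)
    (hY_nonneg : 0 ≤ᵐ[μ] Y) :
    HasSubgammaMGF (fun ω => μ[Y] - Y ω) (∫ ω, Y ω ^ 2 ∂μ) 0 μ := by
  have hmgf := sub_integral_of_exp_le (c := 0) hY.neg fun l hl _ => ?_
  · simpa only [Pi.neg_apply, integral_neg, neg_sq, neg_sub_neg] using hmgf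
  · filter_upwards [hY_nonneg] with ω hω
    simpa [mul_pow, div_mul_eq_mul_div, sub_eq_add_neg] using
      exp_neg_le_one_sub_add_sq_div (mul_nonneg hl hω)

end HasSubgammaMGF

lemma measureReal_lt_sum_sub_integral_le {u : ι → Ω → ℝ} {s : Finset ι} {a b L r : ℝ}
    (hindep : iIndepFun u μ) (hmeas : ∀ i, AEMeasurable (u i) μ) (hab : a ≤ b)
    (hu : ∀ i ∈ s, ∀ᵐ ω ∂μ, u i ω ∈ Set.Icc a b) (hL : 0 ≤ L) (hr : 0 ≤ r)
    (hvr : 2 * (∑ i ∈ s, Var[u i; μ]) * L ≤ r ^ 2) :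
    μ.real {ω | r + (b - a) / 3 * L < ∑ i ∈ s, (u i ω - μ[u i])} ≤ Real.exp (-L) := by
  have : IsProbabilityMeasure μ := hindep.isProbabilityMeasure
  have hcentered : iIndepFun (fun i ω => u i ω - μ[u i]) μ :=
    hindep.comp (fun i x => x - ∫ ω, u i ω ∂μ) fun i => measurable_id.sub_const _
  have hsum := HasSubgammaMGF.sum_of_iIndepFun hcentered (fun i => (hmeas i).sub_const _)
    fun i hi => HasSubgammaMGF.sub_integral_of_mem_Icc (hmeas i) (hu i hi)
  simpa [Finset.sum_apply] using
    hsum.measureReal_add_lt_le (div_nonneg (sub_nonneg.mpr hab) zero_le_three) hL hr hvr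

lemma measureReal_lt_abs_sum_sub_integral_le {u : ι → Ω → ℝ} {s : Finset ι} {a b L r : ℝ}
    (hindep : iIndepFun u μ) (hmeas : ∀ i, AEMeasurable (u i) μ) (hab : a ≤ b)
    (hu : ∀ i ∈ s, ∀ᵐ ω ∂μ, u i ω ∈ Set.Icc a b) (hL : 0 ≤ L) (hr : 0 ≤ r)
    (hvr : 2 * (∑ i ∈ s, Var[u i; μ]) * L ≤ r ^ 2) :
    μ.real {ω | r + (b - a) / 3 * L < |∑ i ∈ s, (u i ω - μ[u i])|} ≤ 2 * Real.exp (-L) := by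
  have : IsProbabilityMeasure μ := hindep.isProbabilityMeasure
  have hupper := measureReal_lt_sum_sub_integral_le hindep hmeas hab hu hL hr hvr
  have hlower := measureReal_lt_sum_sub_integral_le (u := fun i ω => -u i ω) (a := -b) (b := -a)
    (hindep.comp (fun _ x => -x) fun _ => measurable_neg) (fun i => (hmeas i).neg)
    (neg_le_neg hab) (fun i hi => (hu i hi).mono fun ω hω => ⟨neg_le_neg hω.2, neg_le_neg hω.1⟩)
    hL hr (by simpa only [variance_fun_neg] using hvr)
  simp only [integral_neg, neg_sub_neg, ← neg_sub (u _ _), Finset.sum_neg_distrib] at hlower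
  calc μ.real {ω | r + (b - a) / 3 * L < |∑ i ∈ s, (u i ω - μ[u i])|}
      = μ.real ({ω | r + (b - a) / 3 * L < ∑ i ∈ s, (u i ω - μ[u i])} ∪
          {ω | r + (b - a) / 3 * L < -∑ i ∈ s, (u i ω - μ[u i])}) := by
        simp only [lt_abs, Set.ofPred_or]
    _ ≤ 2 * Real.exp (-L) := (measureReal_union_le _ _).trans (by linarith)

lemma measureReal_sum_add_lt_sum_integral_le {Y : ι → Ω → ℝ} {s : Finset ι} {L r : ℝ}
    (hindep : iIndepFun Y μ) (hY : ∀ i, MemLp (Y i) 2 μ) (hY_nonneg : ∀ i ∈ s, 0 ≤ᵐ[μ] Y i)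
    (hL : 0 ≤ L) (hr : 0 ≤ r) (hvr : 2 * (∑ i ∈ s, ∫ ω, Y i ω ^ 2 ∂μ) * L ≤ r ^ 2) :
    μ.real {ω | ∑ i ∈ s, Y i ω + r < ∑ i ∈ s, μ[Y i]} ≤ Real.exp (-L) := by
  have : IsProbabilityMeasure μ := hindep.isProbabilityMeasure
  have hcentered : iIndepFun (fun i ω => μ[Y i] - Y i ω) μ :=
    hindep.comp (fun i x => (∫ ω, Y i ω ∂μ) - x) fun i => measurable_id.const_sub _
  have hsum := HasSubgammaMGF.sum_of_iIndepFun hcentered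
    (fun i => (hY i).aemeasurable.const_sub _)
    fun i hi => HasSubgammaMGF.integral_sub_of_nonneg (hY i) (hY_nonneg i hi)
  simpa [Finset.sum_apply, Finset.sum_sub_distrib, lt_sub_iff_add_lt'] using
    hsum.measureReal_add_lt_le le_rfl hL hr hvr

lemma measureReal_two_mul_sum_integral_add_lt_le {Y : ι → Ω → ℝ} {s : Finset ι} {K L : ℝ}
    (hindep : iIndepFun Y μ) (hmeas : ∀ i, AEMeasurable (Y i) μ) (hK : 0 ≤ K)
    (hY : ∀ i ∈ s, ∀ᵐ ω ∂μ, Y i ω ∈ Set.Icc 0 K) (hL : 0 ≤ L) :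
    μ.real {ω | 2 * ∑ i ∈ s, μ[Y i] + K * L < ∑ i ∈ s, Y i ω} ≤ Real.exp (-L) := by
  have : IsProbabilityMeasure μ := hindep.isProbabilityMeasure
  have hmean_nonneg (i) (hi : i ∈ s) : 0 ≤ μ[Y i] :=
    integral_nonneg_of_ae ((hY i hi).mono fun ω hω => hω.1)
  have hvariance : ∑ i ∈ s, Var[Y i; μ] ≤ K * ∑ i ∈ s, μ[Y i] := by
    rw [Finset.mul_sum]
    gcongr with i hi
    calc Var[Y i; μ] ≤ (K - μ[Y i]) * (μ[Y i] - 0) := variance_le_sub_mul_sub (hY i hi) (hmeas i)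
      _ ≤ K * μ[Y i] := by nlinarith only [hmean_nonneg i hi]
  have hsum_nonneg : 0 ≤ ∑ i ∈ s, μ[Y i] := Finset.sum_nonneg hmean_nonneg
  have hvr : 2 * (∑ i ∈ s, Var[Y i; μ]) * L ≤ (∑ i ∈ s, μ[Y i] + K * L / 2) ^ 2 :=
    calc 2 * (∑ i ∈ s, Var[Y i; μ]) * L ≤ 2 * (K * ∑ i ∈ s, μ[Y i]) * L := by gcongr
      _ = 4 * (∑ i ∈ s, μ[Y i]) * (K * L / 2) := by ring
      _ ≤ (∑ i ∈ s, μ[Y i] + K * L / 2) ^ 2 := four_mul_le_sq_add _ _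
  refine (measureReal_mono ?_).trans
    (measureReal_lt_sum_sub_integral_le hindep hmeas hK hY hL (by positivity) hvr)
  simp only [Finset.sum_sub_distrib, Set.ofPred_subset_ofPred]
  intro ω hω
  linarith [mul_nonneg hK hL]

end Subgamma

section EmpiricalBernstein

variable {Ω ι : Type*} [Fintype ι] {mΩ : MeasurableSpace Ω} {μ : Measure Ω}

/-- The sample standard deviation of the data `x`, with Bessel's correction; it is only meaningful
for at least two data points. -/
noncomputable def sampleStdDev (x : ι → ℝ) : ℝ :=
  √(1 / ((Fintype.card ι : ℝ) - 1) * ∑ i, (x i - 𝔼 j, x j) ^ 2)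

/-- The mean of the uniform mixture of the laws of the variables `u i`. -/
noncomputable def pooledMean (u : ι → Ω → ℝ) (μ : Measure Ω) : ℝ := 𝔼 i, ∫ ω, u i ω ∂μ

/-- The variance of the uniform mixture of the laws of the variables `u i`. It is the quantity that
the sample variance estimates when the `u i` have different means. -/
noncomputable def pooledVariance (u : ι → Ω → ℝ) (μ : Measure Ω) : ℝ :=
  𝔼 i, ∫ ω, (u i ω - pooledMean u μ) ^ 2 ∂μ

lemma sum_sub_expect_sq (x : ι → ℝ) (c : ℝ) :
    ∑ i, (x i - 𝔼 j, x j) ^ 2 = ∑ i, (x i - c) ^ 2 - Fintype.card ι * (𝔼 j, x j - c) ^ 2 := by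
  have hsum : ∑ i, x i = Fintype.card ι * 𝔼 j, x j := (Fintype.card_mul_expect x).symm
  simp only [sub_sq, Finset.sum_add_distrib, Finset.sum_sub_distrib, ← Finset.sum_mul,
    ← Finset.mul_sum, hsum, Finset.sum_const, Finset.card_univ, nsmul_eq_mul]
  ring

lemma sampleStdDev_sq_le (hcard : 2 ≤ Fintype.card ι) (x : ι → ℝ) (c : ℝ) :
    sampleStdDev x ^ 2 ≤ (∑ i, (x i - c) ^ 2) / (Fintype.card ι - 1) := by
  have hcard' : (2 : ℝ) ≤ Fintype.card ι := by exact_mod_cast hcard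
  have hpos : (0 : ℝ) < Fintype.card ι - 1 := by linarith
  rw [sampleStdDev, Real.sq_sqrt (by positivity), one_div_mul_eq_div, sum_sub_expect_sq x c]
  gcongr
  exact sub_le_self _ (by positivity)

lemma expect_sub_sq_sub_sq_le_sampleStdDev_sq (hcard : 2 ≤ Fintype.card ι) (x : ι → ℝ) (c : ℝ) :
    𝔼 i, (x i - c) ^ 2 - (𝔼 i, x i - c) ^ 2 ≤ sampleStdDev x ^ 2 := by
  have hcard' : (2 : ℝ) ≤ Fintype.card ι := by exact_mod_cast hcard
  have hpos : (0 : ℝ) < Fintype.card ι - 1 := by linarith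
  rw [sampleStdDev, Real.sq_sqrt (by positivity), one_div_mul_eq_div]
  calc 𝔼 i, (x i - c) ^ 2 - (𝔼 i, x i - c) ^ 2
      = (∑ i, (x i - 𝔼 j, x j) ^ 2) / Fintype.card ι := by
        rw [sum_sub_expect_sq x c, Fintype.expect_eq_sum_div_card fun i => (x i - c) ^ 2]
        field_simp
    _ ≤ (∑ i, (x i - 𝔼 j, x j) ^ 2) / (Fintype.card ι - 1) := by gcongr; linarith

lemma integral_sub_const_sq [IsProbabilityMeasure μ] {X : Ω → ℝ} (hX : MemLp X 2 μ) (c : ℝ) :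
    ∫ ω, (X ω - c) ^ 2 ∂μ = Var[X; μ] + (μ[X] - c) ^ 2 := by
  have hvar := variance_eq_sub (hX.sub (memLp_const c))
  have hmean : ∫ ω, (X ω - c) ∂μ = μ[X] - c := by
    rw [integral_sub (hX.integrable one_le_two) (integrable_const c), integral_const,
      probReal_univ, one_smul]
  simp only [Pi.pow_apply, Pi.sub_apply, hmean] at hvar
  rw [← variance_sub_const hX.aestronglyMeasurable c]
  exact (sub_eq_iff_eq_add.mp hvar.symm)

lemma pooledVariance_nonneg (u : ι → Ω → ℝ) (μ : Measure Ω) : 0 ≤ pooledVariance u μ :=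
  Finset.expect_nonneg fun _ _ => integral_nonneg fun _ => sq_nonneg _

lemma expect_integral_sub_const_sq [Nonempty ι] [IsProbabilityMeasure μ] {u : ι → Ω → ℝ}
    (hu : ∀ i, MemLp (u i) 2 μ) (c : ℝ) :
    𝔼 i, ∫ ω, (u i ω - c) ^ 2 ∂μ = pooledVariance u μ + (pooledMean u μ - c) ^ 2 := by
  have hmeans := sum_sub_expect_sq (fun i => ∫ ω, u i ω ∂μ) c
  rw [pooledVariance]
  simp only [integral_sub_const_sq (hu _), Finset.expect_add_distrib,
    Fintype.expect_eq_sum_div_card fun i => (μ[u i] - _) ^ 2]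
  rw [← pooledMean] at hmeans
  rw [hmeans]
  field_simp
  ring

lemma card_mul_pooledVariance (u : ι → Ω → ℝ) (μ : Measure Ω) :
    Fintype.card ι * pooledVariance u μ = ∑ i, ∫ ω, (u i ω - pooledMean u μ) ^ 2 ∂μ :=
  Fintype.card_mul_expect _

lemma sum_variance_le_card_mul_pooledVariance [IsProbabilityMeasure μ] {u : ι → Ω → ℝ}
    (hu : ∀ i, MemLp (u i) 2 μ) : ∑ i, Var[u i; μ] ≤ Fintype.card ι * pooledVariance u μ := by
  simp only [card_mul_pooledVariance, integral_sub_const_sq (hu _)]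
  exact Finset.sum_le_sum fun i _ => le_add_of_nonneg_right (sq_nonneg _)

lemma pooledMean_mem_Icc [Nonempty ι] [IsProbabilityMeasure μ] {u : ι → Ω → ℝ} {a b : ℝ}
    (hmeas : ∀ i, AEMeasurable (u i) μ) (hu : ∀ i, ∀ᵐ ω ∂μ, u i ω ∈ Set.Icc a b) :
    pooledMean u μ ∈ Set.Icc a b := by
  have hmean (i) : μ[u i] ∈ Set.Icc a b :=
    (convex_Icc a b).integral_mem isClosed_Icc (hu i) (.of_mem_Icc a b (hmeas i) (hu i))
  exact ⟨Finset.le_expect Finset.univ_nonempty fun i _ => (hmean i).1,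
    Finset.expect_le Finset.univ_nonempty fun i _ => (hmean i).2⟩

lemma pooledVariance_le_sub_mul_sub [Nonempty ι] [IsProbabilityMeasure μ] {u : ι → Ω → ℝ} {a b : ℝ}
    (hmeas : ∀ i, AEMeasurable (u i) μ) (hu : ∀ i, ∀ᵐ ω ∂μ, u i ω ∈ Set.Icc a b) :
    pooledVariance u μ ≤ (b - pooledMean u μ) * (pooledMean u μ - a) := by
  have hu_memLp (i) : MemLp (u i) 2 μ := memLp_of_bounded (hu i) (hmeas i).aestronglyMeasurable 2
  have hmidpoint := expect_integral_sub_const_sq hu_memLp ((a + b) / 2)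
  have hle : 𝔼 i, ∫ ω, (u i ω - (a + b) / 2) ^ 2 ∂μ ≤ ((b - a) / 2) ^ 2 := by
    refine Finset.expect_le Finset.univ_nonempty fun i _ => ?_
    rw [integral_sub_const_sq (hu_memLp i)]
    linarith [variance_le_sub_mul_sub (hu i) (hmeas i)]
  linarith

lemma measureReal_lt_abs_sum_sub_pooledMean_le {u : ι → Ω → ℝ} {a b L : ℝ}
    (hindep : iIndepFun u μ) (hmeas : ∀ i, AEMeasurable (u i) μ) (hab : a ≤ b)
    (hu : ∀ i, ∀ᵐ ω ∂μ, u i ω ∈ Set.Icc a b) (hL : 0 ≤ L) :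
    μ.real {ω | √(2 * (Fintype.card ι * pooledVariance u μ) * L) + (b - a) / 3 * L <
      |∑ i, (u i ω - pooledMean u μ)|} ≤ 2 * Real.exp (-L) := by
  have : IsProbabilityMeasure μ := hindep.isProbabilityMeasure
  have hu_memLp (i) : MemLp (u i) 2 μ := memLp_of_bounded (hu i) (hmeas i).aestronglyMeasurable 2
  have hmean : Fintype.card ι * pooledMean u μ = ∑ i, μ[u i] := Fintype.card_mul_expect _
  have hnonneg := pooledVariance_nonneg u μ
  simp only [Finset.sum_sub_distrib, Finset.sum_const, Finset.card_univ, nsmul_eq_mul, hmean]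
  simp only [← Finset.sum_sub_distrib]
  refine measureReal_lt_abs_sum_sub_integral_le hindep hmeas hab (fun i _ => hu i) hL
    (Real.sqrt_nonneg _) ?_
  rw [Real.sq_sqrt (by positivity)]
  gcongr
  exact sum_variance_le_card_mul_pooledVariance hu_memLp

lemma measureReal_sum_sq_sub_pooledMean_lt_le {u : ι → Ω → ℝ} {K L : ℝ} (hindep : iIndepFun u μ)
    (hmeas : ∀ i, AEMeasurable (u i) μ) (hu : ∀ i, ∀ᵐ ω ∂μ, |u i ω - pooledMean u μ| ≤ K)
    (hK : 0 ≤ K) (hL : 0 ≤ L) :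
    μ.real {ω | ∑ i, (u i ω - pooledMean u μ) ^ 2 +
        K * √(2 * (Fintype.card ι * pooledVariance u μ) * L) <
      Fintype.card ι * pooledVariance u μ} ≤ Real.exp (-L) := by
  have : IsProbabilityMeasure μ := hindep.isProbabilityMeasure
  let Y (i : ι) (ω : Ω) : ℝ := (u i ω - pooledMean u μ) ^ 2
  have hY_mem (i) : ∀ᵐ ω ∂μ, Y i ω ∈ Set.Icc 0 (K ^ 2) := (hu i).mono fun ω hω =>
    ⟨sq_nonneg _, sq_le_sq' (abs_le.mp hω).1 (abs_le.mp hω).2⟩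
  have hY (i) : MemLp (Y i) 2 μ := memLp_of_bounded (hY_mem i)
    (((hmeas i).sub_const _).pow_const 2).aestronglyMeasurable 2
  have hY_sq (i) : ∫ ω, Y i ω ^ 2 ∂μ ≤ K ^ 2 * ∫ ω, Y i ω ∂μ := by
    rw [← integral_const_mul]
    refine integral_mono_ae (hY i).integrable_sq (((hY i).integrable one_le_two).const_mul _) ?_
    filter_upwards [hY_mem i] with ω hω
    exact (sq (Y i ω)).trans_le (mul_le_mul_of_nonneg_right hω.2 hω.1)
  have hnonneg := pooledVariance_nonneg u μ
  have hY_indep : iIndepFun Y μ :=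
    hindep.comp (fun _ x => (x - pooledMean u μ) ^ 2) fun _ => by fun_prop
  rw [card_mul_pooledVariance]
  refine measureReal_sum_add_lt_sum_integral_le hY_indep hY
    (fun i _ => .of_forall fun ω => sq_nonneg _) hL (mul_nonneg hK (Real.sqrt_nonneg _)) ?_
  calc 2 * (∑ i, ∫ ω, Y i ω ^ 2 ∂μ) * L ≤ 2 * (∑ i, K ^ 2 * ∫ ω, Y i ω ∂μ) * L := by
        gcongr with i
        exact hY_sq i
    _ = K ^ 2 * (2 * (∑ i, ∫ ω, Y i ω ∂μ) * L) := by rw [← Finset.mul_sum]; ring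
    _ = (K * √(2 * (∑ i, ∫ ω, Y i ω ∂μ) * L)) ^ 2 := by
        rw [mul_pow, Real.sq_sqrt (by rw [← card_mul_pooledVariance]; positivity)]

lemma measureReal_lt_sum_sq_sub_pooledMean_le {u : ι → Ω → ℝ} {K L : ℝ} (hindep : iIndepFun u μ)
    (hmeas : ∀ i, AEMeasurable (u i) μ) (hu : ∀ i, ∀ᵐ ω ∂μ, |u i ω - pooledMean u μ| ≤ K)
    (hL : 0 ≤ L) :
    μ.real {ω | 2 * (Fintype.card ι * pooledVariance u μ) + K ^ 2 * L <
      ∑ i, (u i ω - pooledMean u μ) ^ 2} ≤ Real.exp (-L) := by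
  rw [card_mul_pooledVariance]
  refine measureReal_two_mul_sum_integral_add_lt_le (Y := fun i ω => (u i ω - pooledMean u μ) ^ 2)
    (hindep.comp (fun _ x => (x - pooledMean u μ) ^ 2) fun _ => by fun_prop)
    (fun i => ((hmeas i).sub_const _).pow_const 2) (sq_nonneg K) (fun i _ => ?_) hL
  filter_upwards [hu i] with ω hω
  exact ⟨sq_nonneg _, sq_le_sq' (abs_le.mp hω).1 (abs_le.mp hω).2⟩

lemma stdDev_le_add_of_deviation_le {v s y M K D : ℝ} (hv : 0 ≤ v) (hs : 0 ≤ s) (hy : 0 ≤ y)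
    (hM : 0 ≤ M) (hD : 0 ≤ D) (hsK : s ^ 2 ≤ K * (M - K)) (hmean : D ≤ s * y + M * y ^ 2 / 6)
    (hvar : s ^ 2 - K * s * y - D ^ 2 ≤ v ^ 2) : s ≤ v + 7 / 6 * (M * y) := by
  -- Squaring the negation bounds `7 / 3 * (s * p) - 49 / 36 * p ^ 2` by `K * s * y + D ^ 2`; after
  -- multiplication by `M ^ 2` every term compares with `s * p`, and the coefficients do not fit.
  by_contra! hlt
  set p := M * y with hp
  have hp_nonneg : 0 ≤ p := mul_nonneg hM hy
  have hps : p ≤ 6 / 7 * s := by linarith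
  have hs_pos : 0 < s := by linarith
  have hMK : M * K ≤ M ^ 2 - s ^ 2 := by nlinarith only [hsK, sq_nonneg (M - K)]
  have hs_le : 4 * s ^ 2 ≤ M ^ 2 := by nlinarith only [hsK, sq_nonneg (M - 2 * K)]
  have hM_pos : 0 < M ^ 2 := (by positivity : 0 < 4 * s ^ 2).trans_le hs_le
  have hv_lt : v ^ 2 < (s - 7 / 6 * p) ^ 2 := by gcongr; linarith
  have hMD : (M * D) ^ 2 ≤ 384 / 343 * s ^ 3 * p := by
    have hMD_le : M * D ≤ 8 / 7 * s * p := by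
      calc M * D ≤ M * (s * y + M * y ^ 2 / 6) := by gcongr
        _ = s * p + p * p / 6 := by rw [hp]; ring
        _ ≤ s * p + (6 / 7 * s) * p / 6 := by gcongr
        _ = 8 / 7 * s * p := by ring
    calc (M * D) ^ 2 ≤ (8 / 7 * s * p) ^ 2 := by gcongr
      _ = 64 / 49 * s ^ 2 * p * p := by ring
      _ ≤ 64 / 49 * s ^ 2 * p * (6 / 7 * s) := by gcongr
      _ = 384 / 343 * s ^ 3 * p := by ring
  have hsp : 0 ≤ s * p := mul_nonneg hs hp_nonneg
  have hkey : M ^ 2 * (7 / 3 * (s * p) - 49 / 36 * p ^ 2) < M ^ 2 * (K * s * y + D ^ 2) := by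
    gcongr
    linarith
  have hpp : M ^ 2 * p ^ 2 ≤ M ^ 2 * (6 / 7 * s * p) := by
    gcongr
    nlinarith only [hps, hp_nonneg]
  have hKsy : M ^ 2 * (K * s * y) ≤ (M ^ 2 - s ^ 2) * (s * p) :=
    calc M ^ 2 * (K * s * y) = M * K * (s * p) := by rw [hp]; ring
      _ ≤ (M ^ 2 - s ^ 2) * (s * p) := by gcongr
  have hsq : 4 * s ^ 2 * (s * p) ≤ M ^ 2 * (s * p) := by gcongr
  linarith [mul_nonneg hM_pos.le hsp]

lemma abs_expect_sub_le_of_deviation_le (hcard : 2 ≤ Fintype.card ι) {x : ι → ℝ} {c V K M L : ℝ}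
    (hV : 0 ≤ V) (hM : 0 ≤ M) (hL : 0 ≤ L) (hVK : V ≤ K * (M - K))
    (hmean : |∑ i, (x i - c)| ≤ √(2 * (Fintype.card ι * V) * L) + M / 3 * L)
    (hvar : Fintype.card ι * V ≤ ∑ i, (x i - c) ^ 2 + K * √(2 * (Fintype.card ι * V) * L)) :
    |𝔼 i, x i - c| ≤ sampleStdDev x * √(2 * L / Fintype.card ι) +
      8 * M * L / (3 * (Fintype.card ι - 1)) := by
  set n : ℝ := (Fintype.card ι : ℝ) with hn
  have hn_two : 2 ≤ n := by rw [hn]; exact_mod_cast hcard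
  set s := √V
  set y := √(2 * L / n)
  have hs_sq : s ^ 2 = V := Real.sq_sqrt hV
  have hy_sq : n * y ^ 2 = 2 * L := by rw [Real.sq_sqrt (by positivity)]; field_simp
  have hsqrt : √(2 * (n * V) * L) = n * (s * y) := by
    rw [← hs_sq,
      show 2 * (n * s ^ 2) * L = (n * (s * y)) ^ 2 by linear_combination -n * s ^ 2 * hy_sq,
      Real.sqrt_sq (by positivity)]
  have hsum : ∑ i, (x i - c) = n * (𝔼 i, x i - c) := by
    rw [mul_sub, Fintype.card_mul_expect, Finset.sum_sub_distrib, Finset.sum_const,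
      Finset.card_univ, nsmul_eq_mul]
  have hsum_sq : ∑ i, (x i - c) ^ 2 = n * 𝔼 i, (x i - c) ^ 2 := (Fintype.card_mul_expect _).symm
  rw [hsqrt, hsum, abs_mul, abs_of_nonneg (by positivity)] at hmean
  rw [hsqrt, hsum_sq] at hvar
  have hD : |𝔼 i, x i - c| ≤ s * y + M * y ^ 2 / 6 := by
    refine le_of_mul_le_mul_left ?_ (by positivity : 0 < n)
    linear_combination hmean - M / 6 * hy_sq
  have hsecond_moment : s ^ 2 - K * s * y ≤ 𝔼 i, (x i - c) ^ 2 := by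
    refine le_of_mul_le_mul_left ?_ (by positivity : 0 < n)
    linear_combination hvar + n * hs_sq
  have hs : s ≤ sampleStdDev x + 7 / 6 * (M * y) := by
    refine stdDev_le_add_of_deviation_le (K := K) (Real.sqrt_nonneg _) (Real.sqrt_nonneg _)
      (Real.sqrt_nonneg _) hM (abs_nonneg (𝔼 i, x i - c)) (hs_sq.trans_le hVK) hD ?_
    rw [sq_abs]
    linarith [expect_sub_sq_sub_sq_le_sampleStdDev_sq hcard x c]
  calc |𝔼 i, x i - c| ≤ s * y + M * y ^ 2 / 6 := hD
    _ ≤ (sampleStdDev x + 7 / 6 * (M * y)) * y + M * y ^ 2 / 6 := by gcongr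
    _ = sampleStdDev x * y + 8 * M * L / (3 * n) := by
        field_simp
        linear_combination 24 * M * hy_sq
    _ ≤ sampleStdDev x * y + 8 * M * L / (3 * (n - 1)) := by gcongr <;> linarith

-- In the lower tail of the sum of squares, replacing this `K` by `b - a` would lose the constant
-- `8 / 3` of the empirical Bernstein bound.
lemma exists_abs_sub_pooledMean_le [Nonempty ι] [IsProbabilityMeasure μ] {u : ι → Ω → ℝ} {a b : ℝ}
    (hmeas : ∀ i, AEMeasurable (u i) μ) (hu : ∀ i, ∀ᵐ ω ∂μ, u i ω ∈ Set.Icc a b) :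
    ∃ K, 0 ≤ K ∧ K ≤ b - a ∧ pooledVariance u μ ≤ K * (b - a - K) ∧
      ∀ i, ∀ᵐ ω ∂μ, |u i ω - pooledMean u μ| ≤ K := by
  obtain ⟨ha, hb⟩ := pooledMean_mem_Icc hmeas hu
  have hV := pooledVariance_le_sub_mul_sub hmeas hu
  refine ⟨max (pooledMean u μ - a) (b - pooledMean u μ), le_max_of_le_left (sub_nonneg.mpr ha),
    max_le (by linarith) (by linarith), ?_, fun i => (hu i).mono fun ω hω => abs_le.mpr ?_⟩
  · rcases max_choice (pooledMean u μ - a) (b - pooledMean u μ) with h | h <;> rw [h] <;> linarith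
  · constructor
    · linarith [hω.1, le_max_left (pooledMean u μ - a) (b - pooledMean u μ)]
    · linarith [hω.2, le_max_right (pooledMean u μ - a) (b - pooledMean u μ)]

theorem measureReal_not_empirical_bernstein_le {u : ι → Ω → ℝ} {a b L : ℝ} (hindep : iIndepFun u μ)
    (hmeas : ∀ i, AEMeasurable (u i) μ) (hu : ∀ i, ∀ᵐ ω ∂μ, u i ω ∈ Set.Icc a b)
    (hcard : 2 ≤ Fintype.card ι) (hL : 0 ≤ L) :
    μ.real {ω | ¬(|𝔼 i, u i ω - pooledMean u μ| ≤
          sampleStdDev (fun i => u i ω) * √(2 * L / Fintype.card ι) +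
            8 * (b - a) * L / (3 * (Fintype.card ι - 1)) ∧
        sampleStdDev (fun i => u i ω) ^ 2 ≤
          (2 * (Fintype.card ι * pooledVariance u μ) + (b - a) ^ 2 * L) / (Fintype.card ι - 1))} ≤
      4 * Real.exp (-L) := by
  have : IsProbabilityMeasure μ := hindep.isProbabilityMeasure
  have : Nonempty ι := Fintype.card_pos_iff.mp (by omega)
  have hcard_one : (1 : ℝ) < Fintype.card ι := by exact_mod_cast hcard
  obtain ⟨K, hK_nonneg, hK_le, hVK, hu_sub⟩ := exists_abs_sub_pooledMean_le hmeas hu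
  have hM : 0 ≤ b - a := hK_nonneg.trans hK_le
  have hmean := measureReal_lt_abs_sum_sub_pooledMean_le hindep hmeas (sub_nonneg.mp hM) hu hL
  have hlower := measureReal_sum_sq_sub_pooledMean_lt_le hindep hmeas hu_sub hK_nonneg hL
  have hupper := measureReal_lt_sum_sq_sub_pooledMean_le hindep hmeas hu_sub hL
  refine (measureReal_mono ?_).trans ((measureReal_union_le _ _).trans
    ((add_le_add (measureReal_union_le _ _) le_rfl).trans
      ((add_le_add (add_le_add hmean hlower) hupper).trans_eq (by ring))))
  intro ω hω
  by_contra hω_good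
  simp only [Set.mem_union, Set.mem_ofPred_eq, not_or, not_lt] at hω_good
  obtain ⟨⟨hω_mean, hω_lower⟩, hω_upper⟩ := hω_good
  refine hω ⟨abs_expect_sub_le_of_deviation_le hcard (pooledVariance_nonneg u μ) hM hL hVK
    hω_mean hω_lower, (sampleStdDev_sq_le hcard _ (pooledMean u μ)).trans ?_⟩
  gcongr
  exact hω_upper.trans (by gcongr)

end EmpiricalBernstein

section Selection

variable {B : ℕ → ℕ} {u : (j : ℕ) → Fin (B j) → ℝ} {M δ : ℝ} {t k : ℕ}

lemma le_phiHat {i : ℕ} (hi : i ∈ Finset.Icc 1 k) :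
    |muHat u t k - muHat u t i| - (psiHat u M δ t k + psiHat u M δ t i) ≤ phiHat u M δ t k :=
  (le_max_left _ 0).trans (le_ciSup (f := fun i : Finset.Icc 1 k =>
    max (|muHat u t k - muHat u t i| - (psiHat u M δ t k + psiHat u M δ t i)) 0)
    (Set.finite_range _).bddAbove ⟨i, hi⟩)

lemma phiHat_nonneg : 0 ≤ phiHat u M δ t k :=
  Real.iSup_nonneg fun _ => le_max_right _ _

lemma phiHat_le_two_mul {A : ℕ → ℝ} {θ β : ℝ} (hk : 1 ≤ k)
    (hdev : ∀ i ∈ Finset.Icc 1 k, |muHat u t i - A i| ≤ psiHat u M δ t i)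
    (hbias : ∀ i ∈ Finset.Icc 1 k, |A i - θ| ≤ β) : phiHat u M δ t k ≤ 2 * β := by
  have hkk : k ∈ Finset.Icc 1 k := Finset.mem_Icc.mpr ⟨hk, le_rfl⟩
  have hβ : 0 ≤ β := (abs_nonneg _).trans (hbias k hkk)
  refine Real.iSup_le (fun ⟨i, hi⟩ => max_le ?_ (by positivity)) (by positivity)
  calc |muHat u t k - muHat u t i| - (psiHat u M δ t k + psiHat u M δ t i)
      ≤ |muHat u t k - A k| + |A k - θ| + (|A i - θ| + |muHat u t i - A i|)
          - (psiHat u M δ t k + psiHat u M δ t i) := by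
        gcongr
        rw [abs_sub_comm (A i), abs_sub_comm (muHat u t i)]
        exact (abs_sub_le _ θ _).trans (add_le_add (abs_sub_le _ _ _) (abs_sub_le _ _ _))
    _ ≤ 2 * β := by linarith [hdev k hkk, hdev i hi, hbias k hkk, hbias i hi]

namespace IsSelectedWindow

lemma abs_muHat_sub_muHat_le {khat : ℕ} (hkhat : IsSelectedWindow u M δ t khat)
    (hk : k ∈ Finset.Icc 1 t) :
    |muHat u t khat - muHat u t k| ≤ 2 * (phiHat u M δ t k + psiHat u M δ t k) := by
  have hmin := hkhat.2 k hk
  have hphi_k : 0 ≤ phiHat u M δ t k := phiHat_nonneg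
  have hphi_khat : 0 ≤ phiHat u M δ t khat := phiHat_nonneg
  rcases le_total khat k with h | h
  · have hle := le_phiHat (u := u) (M := M) (δ := δ) (t := t)
      (Finset.mem_Icc.mpr ⟨(Finset.mem_Icc.mp hkhat.1).1, h⟩)
    rw [abs_sub_comm] at hle
    linarith
  · have hle := le_phiHat (u := u) (M := M) (δ := δ) (t := t)
      (Finset.mem_Icc.mpr ⟨(Finset.mem_Icc.mp hk).1, h⟩)
    linarith

lemma abs_muHat_sub_le {khat : ℕ} {A : ℕ → ℝ} {θ β : ℝ} (hkhat : IsSelectedWindow u M δ t khat)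
    (hk : k ∈ Finset.Icc 1 t)
    (hdev : ∀ i ∈ Finset.Icc 1 k, |muHat u t i - A i| ≤ psiHat u M δ t i)
    (hbias : ∀ i ∈ Finset.Icc 1 k, |A i - θ| ≤ β) :
    |muHat u t khat - θ| ≤ 5 * β + 3 * psiHat u M δ t k := by
  have hk_one : 1 ≤ k := (Finset.mem_Icc.mp hk).1
  have hkk : k ∈ Finset.Icc 1 k := Finset.mem_Icc.mpr ⟨hk_one, le_rfl⟩
  calc |muHat u t khat - θ|
      ≤ |muHat u t khat - muHat u t k| + (|muHat u t k - A k| + |A k - θ|) :=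
        (abs_sub_le _ _ _).trans (add_le_add_right (abs_sub_le _ _ _) _)
    _ ≤ 2 * (2 * β + psiHat u M δ t k) + (psiHat u M δ t k + β) := by
        gcongr
        · refine (hkhat.abs_muHat_sub_muHat_le hk).trans ?_
          gcongr
          exact phiHat_le_two_mul hk_one hdev hbias
        · exact hdev k hkk
        · exact hbias k hkk
    _ = 5 * β + 3 * psiHat u M δ t k := by ring

end IsSelectedWindow

end Selection

section Windows

variable {B : ℕ → ℕ} {m V : ℕ → ℝ} {t k : ℕ}

lemma window_subset_window {i : ℕ} (h : i ≤ k) : window t i ⊆ window t k :=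
  Finset.Icc_subset_Icc_left (by omega)

lemma window_subset_Icc (t k : ℕ) : window t k ⊆ Finset.Icc 1 t :=
  Finset.Icc_subset_Icc_left (by omega)

lemma self_mem_window (hk : k ∈ Finset.Icc 1 t) : t ∈ window t k := by
  rw [Finset.mem_Icc] at hk
  exact Finset.mem_Icc.mpr ⟨by omega, le_rfl⟩

lemma windowSize_pos (hB : ∀ j ∈ Finset.Icc 1 t, 1 ≤ B j) (hk : k ∈ Finset.Icc 1 t) :
    0 < windowSize B t k :=
  Finset.sum_pos (fun j hj => hB j (window_subset_Icc t k hj)) ⟨t, self_mem_window hk⟩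

/-- The samples of the periods in `s`, indexed by a period and the number of the sample within that
period. -/
abbrev SampleIndex (B : ℕ → ℕ) (s : Finset ℕ) : Type := Σ j : s, Fin (B j)

lemma sum_sampleIndex (s : Finset ℕ) (g : (j : ℕ) → Fin (B j) → ℝ) :
    ∑ p : SampleIndex B s, g p.1 p.2 = ∑ j ∈ s, ∑ i, g j i := by
  rw [Fintype.sum_sigma]
  exact Finset.sum_coe_sort s fun j => ∑ i, g j i

lemma card_sampleIndex_window (B : ℕ → ℕ) (t k : ℕ) :
    Fintype.card (SampleIndex B (window t k)) = windowSize B t k := by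
  simp only [Fintype.card_sigma, Fintype.card_fin]
  exact Finset.sum_coe_sort (window t k) B

lemma nonempty_sampleIndex_window (h : 0 < windowSize B t k) :
    Nonempty (SampleIndex B (window t k)) :=
  Fintype.card_pos_iff.mp (h.trans_eq (card_sampleIndex_window B t k).symm)

lemma expect_sampleIndex_window (g : (j : ℕ) → Fin (B j) → ℝ) :
    𝔼 p : SampleIndex B (window t k), g p.1 p.2 =
      (windowSize B t k : ℝ)⁻¹ * ∑ j ∈ window t k, ∑ i, g j i := by
  rw [Fintype.expect_eq_sum_div_card, sum_sampleIndex, card_sampleIndex_window, div_eq_inv_mul]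

lemma muHat_eq_expect (u : (j : ℕ) → Fin (B j) → ℝ) (t k : ℕ) :
    muHat u t k = 𝔼 p : SampleIndex B (window t k), u p.1 p.2 :=
  (expect_sampleIndex_window u).symm

lemma vHat_eq_sampleStdDev (u : (j : ℕ) → Fin (B j) → ℝ) (t k : ℕ) :
    vHat u t k = sampleStdDev fun p : SampleIndex B (window t k) => u p.1 p.2 := by
  rw [vHat, sampleStdDev, ← muHat_eq_expect, card_sampleIndex_window,
    ← sum_sampleIndex _ fun j i => (u j i - muHat u t k) ^ 2]

/-- The largest deviation over the window of the parameters `m j` from the current parameter `m t`: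
the bias incurred by averaging over the window. -/
noncomputable def windowBias (m : ℕ → ℝ) (t k : ℕ) : ℝ := ⨆ j : window t k, |m j - m t|

/-- The square root of the average over the window of the variances `V j`, weighted by the sample
sizes `B j`. -/
noncomputable def windowStdDev (V : ℕ → ℝ) (B : ℕ → ℕ) (t k : ℕ) : ℝ :=
  √(1 / (windowSize B t k : ℝ) * ∑ j ∈ window t k, (B j : ℝ) * V j)

/-- The bias-variance bound of the window `k` for samples with means `m j` and variances `V j`;
`oracleBound` is its instance for the loss differences. -/
noncomputable def biasVarianceBound (m V : ℕ → ℝ) (B : ℕ → ℕ) (t k : ℕ) : ℝ :=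
  windowBias m t k + windowStdDev V B t k / √(windowSize B t k : ℝ) +
    1 / (windowSize B t k : ℝ)

lemma windowBias_nonneg : 0 ≤ windowBias m t k :=
  Real.iSup_nonneg fun _ => abs_nonneg _

lemma windowStdDev_nonneg : 0 ≤ windowStdDev V B t k :=
  Real.sqrt_nonneg _

lemma abs_sub_le_windowBias {j : ℕ} (hj : j ∈ window t k) : |m j - m t| ≤ windowBias m t k :=
  le_ciSup (f := fun j : window t k => |m j - m t|) (Set.finite_range _).bddAbove ⟨j, hj⟩

lemma biasVarianceBound_nonneg : 0 ≤ biasVarianceBound m V B t k :=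
  add_nonneg (add_nonneg windowBias_nonneg (div_nonneg windowStdDev_nonneg (Real.sqrt_nonneg _)))
    (by positivity)

lemma windowBias_le_biasVarianceBound : windowBias m t k ≤ biasVarianceBound m V B t k := by
  have hvar : 0 ≤ windowStdDev V B t k / √(windowSize B t k : ℝ) :=
    div_nonneg windowStdDev_nonneg (Real.sqrt_nonneg _)
  rw [biasVarianceBound, add_assoc]
  exact le_add_of_nonneg_right (by positivity)

lemma inv_windowSize_le_biasVarianceBound :
    1 / (windowSize B t k : ℝ) ≤ biasVarianceBound m V B t k :=
  le_add_of_nonneg_left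
    (add_nonneg windowBias_nonneg (div_nonneg windowStdDev_nonneg (Real.sqrt_nonneg _)))

end Windows

section MeanEstimation

variable {Ω ι : Type*} {mΩ : MeasurableSpace Ω} {μ : Measure Ω}

lemma abs_pooledMean_sub_le [Fintype ι] [Nonempty ι] {u : ι → Ω → ℝ} {c β : ℝ}
    (hβ : ∀ i, |μ[u i] - c| ≤ β) : |pooledMean u μ - c| ≤ β := by
  rw [pooledMean, ← Fintype.expect_const (ι := ι) c, ← Finset.expect_sub_distrib]
  exact (Finset.abs_expect_le _ _).trans
    (Finset.expect_le Finset.univ_nonempty fun i _ => hβ i)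

lemma pooledVariance_le_expect_variance_add_sq [Fintype ι] [Nonempty ι] [IsProbabilityMeasure μ]
    {u : ι → Ω → ℝ} {c β : ℝ} (hu : ∀ i, MemLp (u i) 2 μ) (hβ : ∀ i, |μ[u i] - c| ≤ β) :
    pooledVariance u μ ≤ 𝔼 i, Var[u i; μ] + β ^ 2 :=
  calc pooledVariance u μ ≤ 𝔼 i, ∫ ω, (u i ω - c) ^ 2 ∂μ :=
        (le_add_of_nonneg_right (sq_nonneg _)).trans_eq (expect_integral_sub_const_sq hu c).symm
    _ ≤ 𝔼 i, (Var[u i; μ] + β ^ 2) := by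
        gcongr with i
        rw [integral_sub_const_sq (hu i), ← sq_abs (_ - c)]
        gcongr
        exact hβ i
    _ = 𝔼 i, Var[u i; μ] + β ^ 2 := by rw [Finset.expect_add_distrib, Fintype.expect_const]

lemma empirical_width_le {n v σ β M L : ℝ} (hn : 2 ≤ n) (hσ : 0 ≤ σ) (hβ : 0 ≤ β) (hM : 0 ≤ M)
    (hL : 1 ≤ L) (hv : v ^ 2 ≤ (2 * (n * (σ ^ 2 + β ^ 2)) + M ^ 2 * L) / (n - 1)) :
    v * √(2 * L / n) + 8 * M * L / (3 * (n - 1)) ≤ 8 * max 1 M * L * (β + σ / √n + 1 / n) := by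
  set q := √(2 * L / n)
  have hn_sub : n / 2 ≤ n - 1 := by linarith
  have : 0 ≤ q := Real.sqrt_nonneg _
  have hq_sq : q ^ 2 = 2 * L / n := Real.sq_sqrt (by positivity)
  have hLL : L ≤ L ^ 2 := by nlinarith only [hL]
  have hq_le : q ≤ L := by
    refine abs_le_of_sq_le_sq' ?_ (by positivity) |>.2
    calc q ^ 2 ≤ 2 * L / 2 := by rw [hq_sq]; gcongr
      _ ≤ L ^ 2 := by linarith
  have hq_le_div : q ≤ 2 * (L / √n) := by
    refine abs_le_of_sq_le_sq' ?_ (by positivity) |>.2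
    calc q ^ 2 ≤ 4 * L ^ 2 / n := by rw [hq_sq]; gcongr; linarith
      _ = (2 * (L / √n)) ^ 2 := by rw [mul_pow, div_pow, Real.sq_sqrt (by positivity)]; ring
  have hv_le : v ≤ 2 * σ + 2 * β + M * q := by
    refine abs_le_of_sq_le_sq' ?_ (by positivity) |>.2
    calc v ^ 2 ≤ (2 * (n * (σ ^ 2 + β ^ 2)) + M ^ 2 * L) / (n / 2) := hv.trans (by gcongr)
      _ = 4 * σ ^ 2 + 4 * β ^ 2 + M ^ 2 * q ^ 2 := by rw [hq_sq]; field_simp; ring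
      _ ≤ (2 * σ + 2 * β + M * q) ^ 2 := by
          have : 0 ≤ 8 * (σ * β) + 4 * (σ * (M * q)) + 4 * (β * (M * q)) := by positivity
          linarith
  calc v * q + 8 * M * L / (3 * (n - 1))
      ≤ (2 * σ + 2 * β + M * q) * q + 8 * M * L / (3 * (n / 2)) := by gcongr
    _ = 2 * σ * q + 2 * β * q + M * q ^ 2 + 8 * M * L / (3 * (n / 2)) := by ring
    _ ≤ 2 * σ * (2 * (L / √n)) + 2 * β * L + M * (2 * L / n) + 8 * M * L / (3 * (n / 2)) := by
        rw [hq_sq]; gcongr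
    _ = 1 * (2 * L * β + 4 * (L * (σ / √n))) + M * (22 / 3 * (L * (1 / n))) := by ring
    _ ≤ max 1 M * (2 * L * β + 4 * (L * (σ / √n))) + max 1 M * (22 / 3 * (L * (1 / n))) := by
        gcongr
        exacts [le_max_left _ _, le_max_right _ _]
    _ ≤ max 1 M * (8 * L * β + 8 * (L * (σ / √n))) + max 1 M * (8 * (L * (1 / n))) := by
        gcongr <;> norm_num
    _ = 8 * max 1 M * L * (β + σ / √n + 1 / n) := by ring

variable {B : ℕ → ℕ} {u : (j : ℕ) → Fin (B j) → Ω → ℝ} {m V : ℕ → ℝ} {a b : ℝ} {t k : ℕ}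

/-- The samples `u j i` of the periods `j ∈ s` are independent with values in `[a, b]`, and those of
period `j` have mean `m j` and variance `V j`. Within a period the laws may differ. -/
structure IsBoundedSampling (u : (j : ℕ) → Fin (B j) → Ω → ℝ) (m V : ℕ → ℝ) (a b : ℝ)
    (s : Finset ℕ) (μ : Measure Ω) : Prop where
  iIndepFun : iIndepFun (fun p : SampleIndex B s => u p.1 p.2) μ
  aemeasurable (p : SampleIndex B s) : AEMeasurable (u p.1 p.2) μ
  mem_Icc (p : SampleIndex B s) : ∀ᵐ ω ∂μ, u p.1 p.2 ω ∈ Set.Icc a b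
  integral_eq (p : SampleIndex B s) : ∫ ω, u p.1 p.2 ω ∂μ = m p.1
  variance_eq (p : SampleIndex B s) : Var[u p.1 p.2; μ] = V p.1

namespace IsBoundedSampling

lemma mono {s s' : Finset ℕ} (h : IsBoundedSampling u m V a b s' μ) (hs : s ⊆ s') :
    IsBoundedSampling u m V a b s μ := by
  let incl : SampleIndex B s → SampleIndex B s' :=
    Sigma.map (fun j => ⟨j, hs j.2⟩) fun _ => id
  have hincl : Function.Injective incl :=
    (Subtype.map_injective hs Function.injective_id).sigma_map fun _ => Function.injective_id
  exact ⟨h.iIndepFun.precomp hincl, fun p => h.aemeasurable (incl p), fun p => h.mem_Icc (incl p),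
    fun p => h.integral_eq (incl p), fun p => h.variance_eq (incl p)⟩

lemma memLp {s : Finset ℕ} (h : IsBoundedSampling u m V a b s μ) (p : SampleIndex B s) :
    MemLp (u p.1 p.2) 2 μ :=
  have := h.iIndepFun.isProbabilityMeasure
  memLp_of_bounded (h.mem_Icc p) (h.aemeasurable p).aestronglyMeasurable 2

lemma expect_variance_eq (h : IsBoundedSampling u m V a b (window t k) μ) :
    𝔼 p : SampleIndex B (window t k), Var[u p.1 p.2; μ] = windowStdDev V B t k ^ 2 := by
  have hnonneg : 0 ≤ 𝔼 p : SampleIndex B (window t k), Var[u p.1 p.2; μ] :=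
    Finset.expect_nonneg fun p _ => variance_nonneg _ _
  have hexpect : 𝔼 p : SampleIndex B (window t k), Var[u p.1 p.2; μ] =
      1 / (windowSize B t k : ℝ) * ∑ j ∈ window t k, (B j : ℝ) * V j := by
    simp only [h.variance_eq, expect_sampleIndex_window fun j _ => V j, Finset.sum_const,
      Finset.card_univ, Fintype.card_fin, nsmul_eq_mul, one_div]
  rw [windowStdDev, ← hexpect, Real.sq_sqrt hnonneg]

lemma abs_integral_sub_le_windowBias {i : ℕ} (h : IsBoundedSampling u m V a b (window t i) μ)
    (hik : i ≤ k) (p : SampleIndex B (window t i)) :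
    |∫ ω, u p.1 p.2 ω ∂μ - m t| ≤ windowBias m t k := by
  rw [h.integral_eq p]
  exact abs_sub_le_windowBias (window_subset_window hik p.1.2)

lemma abs_pooledMean_sub_le_windowBias {i : ℕ} (h : IsBoundedSampling u m V a b (window t i) μ)
    (hsize : 0 < windowSize B t i) (hik : i ≤ k) :
    |pooledMean (fun p : SampleIndex B (window t i) => u p.1 p.2) μ - m t| ≤ windowBias m t k :=
  have := nonempty_sampleIndex_window hsize
  abs_pooledMean_sub_le (h.abs_integral_sub_le_windowBias hik)

lemma pooledVariance_le (h : IsBoundedSampling u m V a b (window t k) μ)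
    (hsize : 0 < windowSize B t k) :
    pooledVariance (fun p : SampleIndex B (window t k) => u p.1 p.2) μ ≤
      windowStdDev V B t k ^ 2 + windowBias m t k ^ 2 := by
  have := h.iIndepFun.isProbabilityMeasure
  have := nonempty_sampleIndex_window hsize
  rw [← h.expect_variance_eq]
  exact pooledVariance_le_expect_variance_add_sq h.memLp (h.abs_integral_sub_le_windowBias le_rfl)

lemma ae_abs_muHat_sub_le_psiHat_of_windowSize_eq_one
    (h : IsBoundedSampling u m V a b (window t k) μ) (hsize : windowSize B t k = 1)
    {δ : ℝ} (hL : 1 ≤ Real.log (2 / δ)) :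
    ∀ᵐ ω ∂μ, |muHat (fun j i => u j i ω) t k -
          pooledMean (fun p : SampleIndex B (window t k) => u p.1 p.2) μ| ≤
        psiHat (fun j i => u j i ω) (b - a) δ t k ∧
      psiHat (fun j i => u j i ω) (b - a) δ t k ≤
        8 * max 1 (b - a) * Real.log (2 / δ) * biasVarianceBound m V B t k := by
  have := h.iIndepFun.isProbabilityMeasure
  have := nonempty_sampleIndex_window (hsize.symm ▸ one_pos)
  have hmean := pooledMean_mem_Icc h.aemeasurable h.mem_Icc
  have hbound : 1 ≤ biasVarianceBound m V B t k := by
    simpa [hsize] using inv_windowSize_le_biasVarianceBound (m := m) (V := V) (B := B) (t := t)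
      (k := k)
  filter_upwards [ae_all_iff.mpr h.mem_Icc] with ω hω
  rw [psiHat, if_pos hsize, muHat_eq_expect]
  constructor
  · exact abs_sub_le_of_le_of_le (Finset.le_expect Finset.univ_nonempty fun p _ => (hω p).1)
      (Finset.expect_le Finset.univ_nonempty fun p _ => (hω p).2) hmean.1 hmean.2
  · calc b - a ≤ 8 * max 1 (b - a) * 1 * 1 := by
          linarith [le_max_right 1 (b - a), le_max_left 1 (b - a)]
      _ ≤ 8 * max 1 (b - a) * Real.log (2 / δ) * biasVarianceBound m V B t k := by gcongr

lemma measureReal_not_abs_muHat_sub_le_psiHat_le (h : IsBoundedSampling u m V a b (window t k) μ)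
    (hsize : 0 < windowSize B t k) {δ : ℝ} (hL : 1 ≤ Real.log (2 / δ)) :
    μ.real {ω | ¬(|muHat (fun j i => u j i ω) t k -
          pooledMean (fun p : SampleIndex B (window t k) => u p.1 p.2) μ| ≤
        psiHat (fun j i => u j i ω) (b - a) δ t k ∧
      psiHat (fun j i => u j i ω) (b - a) δ t k ≤
        8 * max 1 (b - a) * Real.log (2 / δ) * biasVarianceBound m V B t k)} ≤
      4 * Real.exp (-Real.log (2 / δ)) := by
  have := h.iIndepFun.isProbabilityMeasure
  obtain hone | htwo : windowSize B t k = 1 ∨ 2 ≤ windowSize B t k := by omega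
  · rw [measureReal_def, ae_iff.mp (h.ae_abs_muHat_sub_le_psiHat_of_windowSize_eq_one hone hL),
      ENNReal.toReal_zero]
    positivity
  have hcard := card_sampleIndex_window B t k
  have hM : 0 ≤ b - a := by
    obtain ⟨p⟩ := nonempty_sampleIndex_window hsize
    obtain ⟨ω, hω⟩ := (h.mem_Icc p).exists
    exact sub_nonneg.mpr (hω.1.trans hω.2)
  refine (measureReal_mono ?_).trans (measureReal_not_empirical_bernstein_le h.iIndepFun
    h.aemeasurable h.mem_Icc (htwo.trans_eq hcard.symm) (zero_le_one.trans hL))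
  rw [Set.ofPred_subset_ofPred, hcard]
  intro ω
  rw [not_imp_not, psiHat, if_neg (by omega), muHat_eq_expect, vHat_eq_sampleStdDev]
  refine fun ⟨hdev, hvar⟩ => ⟨hdev, empirical_width_le (by exact_mod_cast htwo) windowStdDev_nonneg
    windowBias_nonneg hM hL (hvar.trans ?_)⟩
  have : (1 : ℝ) < windowSize B t k := by exact_mod_cast htwo
  gcongr
  exact h.pooledVariance_le hsize

end IsBoundedSampling

lemma one_sub_sum_measureReal_not_le [IsProbabilityMeasure μ] (s : Finset ι) (p : ι → Ω → Prop) :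
    1 - ∑ i ∈ s, μ.real {ω | ¬p i ω} ≤ μ.real {ω | ∀ i ∈ s, p i ω} := by
  have hcover : Set.univ ⊆ {ω | ∀ i ∈ s, p i ω} ∪ ⋃ i ∈ s, {ω | ¬p i ω} := fun ω _ => by
    by_cases hω : ∀ i ∈ s, p i ω
    · exact Or.inl hω
    · push Not at hω
      obtain ⟨i, hi, hpi⟩ := hω
      exact Or.inr (Set.mem_biUnion hi hpi)
  have hle := (measureReal_mono (μ := μ) hcover).trans (measureReal_union_le _ _)
  rw [probReal_univ] at hle
  linarith [measureReal_biUnion_finset_le (μ := μ) s fun i => {ω | ¬p i ω}]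

theorem IsBoundedSampling.abs_muHat_selected_sub_le
    (h : IsBoundedSampling u m V a b (Finset.Icc 1 t) μ) (hB : ∀ j ∈ Finset.Icc 1 t, 1 ≤ B j)
    {δ : ℝ} (hδ : 0 < δ) (hL : 1 ≤ Real.log (2 / δ)) :
    1 - 2 * t * δ ≤ μ.real {ω | ∀ khat, IsSelectedWindow (fun j i => u j i ω) (b - a) δ t khat →
      ∀ k ∈ Finset.Icc 1 t, |muHat (fun j i => u j i ω) t khat - m t| ≤
        29 * max 1 (b - a) * Real.log (2 / δ) * biasVarianceBound m V B t k} := by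
  have := h.iIndepFun.isProbabilityMeasure
  have hwindow (k) := h.mono (window_subset_Icc t k)
  have hfail (k) (hk : k ∈ Finset.Icc 1 t) :=
    (hwindow k).measureReal_not_abs_muHat_sub_le_psiHat_le (windowSize_pos hB hk) hL
  have hexp : 4 * Real.exp (-Real.log (2 / δ)) = 2 * δ := by
    rw [Real.exp_neg, Real.exp_log (by positivity)]
    field_simp
    norm_num
  have hsum := Finset.sum_le_card_nsmul _ _ _ hfail
  rw [hexp, Nat.card_Icc, Nat.add_sub_cancel, nsmul_eq_mul] at hsum
  refine (by linarith : 1 - 2 * t * δ ≤ _).trans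
    ((one_sub_sum_measureReal_not_le _ _).trans (measureReal_mono ?_))
  intro ω hω khat hkhat k hk
  have hkt : k ≤ t := (Finset.mem_Icc.mp hk).2
  have hmean := hkhat.abs_muHat_sub_le hk
    (fun i hi => (hω i (Finset.Icc_subset_Icc_right hkt hi)).1)
    (fun i hi => (hwindow i).abs_pooledMean_sub_le_windowBias
      (windowSize_pos hB (Finset.Icc_subset_Icc_right hkt hi)) (Finset.mem_Icc.mp hi).2)
  have hbound : windowBias m t k ≤
      max 1 (b - a) * Real.log (2 / δ) * biasVarianceBound m V B t k :=
    windowBias_le_biasVarianceBound.trans (le_mul_of_one_le_left biasVarianceBound_nonneg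
      (one_le_mul_of_one_le_of_one_le (le_max_left _ _) hL))
  linarith [(hω k hk).2]

end MeanEstimation

section Comparison

variable {F Z Ω : Type*} {mΩ : MeasurableSpace Ω} {μ : Measure Ω} [MeasurableSpace Z]
  {ℓ : F → Z → ℝ} {f₁ f₂ : F} {P : ℕ → Measure Z} {B : ℕ → ℕ} {a b : ℝ}

lemma isBoundedSampling_lossDiff (hmeas₁ : Measurable (ℓ f₁)) (hmeas₂ : Measurable (ℓ f₂))
    (hℓ₁ : ∀ x, ℓ f₁ x ∈ Set.Icc a b) (hℓ₂ : ∀ x, ℓ f₂ x ∈ Set.Icc a b)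
    {z : (j : ℕ) → Fin (B j) → Ω → Z} {s : Finset ℕ}
    (hz_law : ∀ j ∈ s, ∀ i, HasLaw (z j i) (P j) μ)
    (hz_indep : iIndepFun (fun p : SampleIndex B s => z p.1 p.2) μ) :
    IsBoundedSampling (fun j i ω => lossDiff ℓ f₁ f₂ (fun j i => z j i ω) j i) (gap ℓ P f₁ f₂)
      (fun j => Var[fun x => ℓ f₁ x - ℓ f₂ x; P j]) (a - b) (b - a) s μ := by
  have hmeas : Measurable fun x => ℓ f₁ x - ℓ f₂ x := hmeas₁.sub hmeas₂
  have := hz_indep.isProbabilityMeasure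
  have hlaw (p : SampleIndex B s) : HasLaw (z p.1 p.2) (P p.1) μ := hz_law p.1 p.1.2 p.2
  refine ⟨hz_indep.comp (fun _ x => ℓ f₁ x - ℓ f₂ x) fun _ => hmeas,
    fun p => hmeas.comp_aemeasurable (hlaw p).aemeasurable,
    fun p => .of_forall fun ω => ⟨sub_le_sub (hℓ₁ _).1 (hℓ₂ _).2,
      sub_le_sub (hℓ₁ _).2 (hℓ₂ _).1⟩, fun p => ?_, fun p => ?_⟩
  · have := (hlaw p).isProbabilityMeasure_iff.mp inferInstance
    exact ((hlaw p).integral_comp hmeas.aestronglyMeasurable).trans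
      (integral_sub (.of_mem_Icc a b hmeas₁.aemeasurable (.of_forall hℓ₁))
        (.of_mem_Icc a b hmeas₂.aemeasurable (.of_forall hℓ₂)))
  · rw [← (hlaw p).map_eq, variance_map hmeas.aemeasurable (hlaw p).aemeasurable]
    rfl

lemma risk_sub_min_le_of_abs_muHat_sub_gap_le {z : (j : ℕ) → Fin (B j) → Z} {M δ ε : ℝ} {t : ℕ}
    (hε : ∀ khat, IsSelectedWindow (lossDiff ℓ f₁ f₂ z) M δ t khat →
      |muHat (lossDiff ℓ f₁ f₂ z) t khat - gap ℓ P f₁ f₂ t| ≤ ε)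
    {fhat : F} (hfhat : IsCompareOutput ℓ f₁ f₂ z M δ t fhat) :
    risk ℓ (P t) fhat - min (risk ℓ (P t) f₁) (risk ℓ (P t) f₂) ≤ ε := by
  obtain ⟨khat, hkhat, hchoice⟩ := hfhat
  obtain ⟨hlower, hupper⟩ := abs_le.mp (hε khat hkhat)
  rw [gap] at hlower hupper
  rw [sub_le_comm, le_min_iff]
  rcases hchoice with ⟨hmu, rfl⟩ | ⟨hmu, rfl⟩ <;> constructor <;> linarith

theorem one_sub_le_measureReal_risk_sub_min_le (hmeas₁ : Measurable (ℓ f₁))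
    (hmeas₂ : Measurable (ℓ f₂)) (hℓ₁ : ∀ x, ℓ f₁ x ∈ Set.Icc a b) (hℓ₂ : ∀ x, ℓ f₂ x ∈ Set.Icc a b)
    {z : (j : ℕ) → Fin (B j) → Ω → Z} {t : ℕ} (hB : ∀ j ∈ Finset.Icc 1 t, 1 ≤ B j)
    (hz_law : ∀ j ∈ Finset.Icc 1 t, ∀ i, HasLaw (z j i) (P j) μ)
    (hz_indep : iIndepFun (fun p : SampleIndex B (Finset.Icc 1 t) => z p.1 p.2) μ)
    {δ : ℝ} (hδ : 0 < δ) (hL : 1 ≤ Real.log (2 / δ)) :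
    1 - 2 * t * δ ≤ μ.real {ω | ∀ fhat,
      IsCompareOutput ℓ f₁ f₂ (fun j i => z j i ω) (2 * (b - a)) δ t fhat → ∀ k ∈ Finset.Icc 1 t,
        risk ℓ (P t) fhat - min (risk ℓ (P t) f₁) (risk ℓ (P t) f₂) ≤
          58 * max 1 (b - a) * Real.log (2 / δ) * oracleBound ℓ P B f₁ f₂ t k} := by
  have := hz_indep.isProbabilityMeasure
  have hgap := (isBoundedSampling_lossDiff hmeas₁ hmeas₂ hℓ₁ hℓ₂ hz_law
    hz_indep).abs_muHat_selected_sub_le hB hδ hL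
  rw [show b - a - (a - b) = 2 * (b - a) by ring] at hgap
  have hmax : max 1 (2 * (b - a)) ≤ 2 * max 1 (b - a) :=
    max_le (by linarith [le_max_left 1 (b - a)]) (by linarith [le_max_right 1 (b - a)])
  refine hgap.trans (measureReal_mono fun ω hω fhat hfhat k hk => ?_)
  calc risk ℓ (P t) fhat - min (risk ℓ (P t) f₁) (risk ℓ (P t) f₂)
      ≤ 29 * max 1 (2 * (b - a)) * Real.log (2 / δ) * oracleBound ℓ P B f₁ f₂ t k :=
        risk_sub_min_le_of_abs_muHat_sub_gap_le (fun khat hkhat => hω khat hkhat k hk) hfhat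
    _ ≤ 29 * (2 * max 1 (b - a)) * Real.log (2 / δ) * oracleBound ℓ P B f₁ f₂ t k := by
        gcongr
        exact biasVarianceBound_nonneg
    _ = 58 * max 1 (b - a) * Real.log (2 / δ) * oracleBound ℓ P B f₁ f₂ t k := by ring

end Comparison

end RollingWindow

theorem mainTheorem2 :
    ∃ C : ℝ, 0 < C ∧
      ∀ (F : Type*) (Z : Type*) [MeasurableSpace Z] (ℓ : F → Z → ℝ) (a b : ℝ)
        (_ : ∀ f, Measurable (ℓ f)) (_ : ∀ f z, ℓ f z ∈ Set.Icc a b)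
        (f₁ f₂ : F) (t : ℕ) (_ : 1 ≤ t)
        (P : ℕ → Measure Z) [∀ j, IsProbabilityMeasure (P j)]
        (B : ℕ → ℕ) (_ : ∀ j ∈ Finset.Icc 1 t, 1 ≤ B j)
        (Ω : Type*) [MeasurableSpace Ω] (μ : Measure Ω) [IsProbabilityMeasure μ]
        (z : (j : ℕ) → Fin (B j) → Ω → Z)
        (_ : ∀ j ∈ Finset.Icc 1 t, ∀ i, HasLaw (z j i) (P j) μ)
        (_ : iIndepFun (fun p : (Σ j : Finset.Icc 1 t, Fin (B j)) => z p.1 p.2) μ)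
        (δ : ℝ) (_ : δ ∈ Set.Ioo (0 : ℝ) 1),
        1 - δ ≤ μ.real {ω | ∀ fhat : F,
          RollingWindow.IsCompareOutput ℓ f₁ f₂ (fun j i => z j i ω)
              (2 * (b - a)) (δ / (3 * t)) t fhat →
            RollingWindow.risk ℓ (P t) fhat
                - min (RollingWindow.risk ℓ (P t) f₁) (RollingWindow.risk ℓ (P t) f₂)
              ≤ C * max 1 (b - a) * Real.log (6 * t / δ) *
                ⨅ k : Finset.Icc 1 t, RollingWindow.oracleBound ℓ P B f₁ f₂ t k} := by
  refine ⟨58, by norm_num, ?_⟩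
  intro F Z _ ℓ a b hℓ_meas hℓ f₁ f₂ t ht P _ B hB Ω _ μ _ z hz_law hz_indep δ ⟨hδ_pos, hδ_lt⟩
  have ht_one : (1 : ℝ) ≤ t := by exact_mod_cast ht
  have hlevel : 2 / (δ / (3 * t)) = 6 * t / δ := by field_simp; norm_num
  have hlevel_sum : 2 * t * (δ / (3 * t)) ≤ δ :=
    calc 2 * t * (δ / (3 * t)) = 2 / 3 * δ := by field_simp
      _ ≤ δ := by linarith
  have hbound := RollingWindow.one_sub_le_measureReal_risk_sub_min_le (hℓ_meas f₁) (hℓ_meas f₂)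
    (hℓ f₁) (hℓ f₂) hB hz_law hz_indep (δ := δ / (3 * t)) (by positivity)
    (hlevel ▸ RollingWindow.one_le_log_six_mul_div ht_one hδ_pos (by linarith))
  rw [hlevel] at hbound
  have : Nonempty (Finset.Icc 1 t) := ⟨⟨1, Finset.mem_Icc.mpr ⟨le_rfl, ht⟩⟩⟩
  obtain ⟨k, hk⟩ := exists_eq_ciInf_of_finite
    (f := fun k : Finset.Icc 1 t => RollingWindow.oracleBound ℓ P B f₁ f₂ t k)
  refine (sub_le_sub_left hlevel_sum 1).trans (hbound.trans (measureReal_mono ?_))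
  intro ω hω fhat hfhat
  rw [← hk]
  exact hω fhat hfhat k k.2
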